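/- **Conventions.** All spaces $\mathbb R^s$ carry the Euclidean norm, products carry $\|(u,v)\|=\sqrt{\|u\|^2+\|v\|^2}$. For $A\subseteq\mathbb R^s$ and $x\in A$ let $T_A(x)=\{u \mid \exists\, t_k\downarrow 0,\ u_k\to u:\ x+t_ku_k\in A\ \forall k\}$ be the tangent cone, $\widehat N_A(x)=\{x^*\mid \langle x^*,u\rangle\le 0\ \forall u\in T_A(x)\}$ the regular normal cone, and $T^\sharp_A(x)=\{u\mid \exists\, x_k\to x,\ u_k\to u:\ x_k\in A,\ u_k\in T_A(x_k)\ \forall k\}$ the outer limiting tangent cone. For $F:\mathbb R^n\rightrightarrows\mathbb R^m$ and $(x,y)\in\mathrm{gph}\,F$ define $DF(x,y)$, $D^\sharp F(x,y):\mathbb R^n\rightrightarrows\mathbb R^m$ and $\widehat D^*F(x,y):\mathbb R^m\rightrightarrows\mathbb R^n$ by $$\mathrm{gph}\,DF(x,y)=T_{\mathrm{gph}F}(x,y),\quad \mathrm{gph}\,D^\sharp F(x,y)=T^\sharp_{\mathrm{gph}F}(x,y),\quad \mathrm{gph}\,\widehat D^*F(x,y)=\{(y^*,x^*)\mid (x^*,-y^*)\in\widehat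 N_{\mathrm{gph}F}(x,y)\}.$$ Let $\mathcal O_F$ be the set of those $(x,y)\in\mathrm{gph}\,F$ at which $T_{\mathrm{gph}F}(x,y)$ is a linear subspace of dimension $n$. Measure the distance of two subspaces by the operator norm of the difference of the orthogonal projections onto them. Let $\mathcal SF(x,y)$ be the set of all $n$-dimensional subspaces $L\subseteq\mathbb R^n\times\mathbb R^m$ that are limits of $\mathrm{gph}\,DF(x_k,y_k)$ for some sequence $(x_k,y_k)\to(x,y)$ in $\mathcal O_F$, and $\mathcal S^*F(x,y)$ the set of all $m$-dimensional subspaces $L^*\subseteq\mathbb R^m\times\mathbb R^n$ that are limits of $\mathrm{gph}\,\widehat D^*F(x_k,y_k)$ for some such sequence. $F$ has the SCD property at $(x,y)\in\mathrm{gph}\,F$ if $\mathcal S^*F(x,y)\ne\emptyset$. $F$ is semismooth$^*$ at $(\bar x,\bar y)\in\mathrm{gph}\,F$ if for every $\epsilon>0$ there is $\delta>0$ with $$|\langle x^*,x-\bar x\rangle-\langle y^*,y-\bar y\rangle|\le\epsilon\,\|(x,y)-(\bar x,\bar y)\|\,\|(x^*,y^*)\|$$ for all $(x,y)\in\mathrm{gph}\,F$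 with $\|(x,y)-(\bar x,\bar y)\|\le\delta$ and all $(y^*,x^*)\in\mathrm{gph}\,\widehat D^*F(x,y)$. Either property holds *around* a point if it holds at all points of $\mathrm{gph}\,F$ in a neighborhood of that point. A mapping $S:\mathbb R^l\rightrightarrows\mathbb R^k$ is *isolatedly calm around* $(\bar x,\bar y)\in\mathrm{gph}\,S$ if there are $\kappa\ge0$ and a neighborhood $W$ of $(\bar x,\bar y)$ such that for every $(x,y)\in\mathrm{gph}\,S\cap W$ there is a neighborhood $U$ of $y$ with $\|y'-y\|\le\kappa\|x'-x\|$ for all $x'\in\mathbb R^l$ and all $y'\in S(x')\cap U$. **Proposition.** Let $f:\mathbb R^l\times\mathbb R^k\to\mathbb R^k$ be continuously differentiable, let $Q:\mathbb R^l\times\mathbb R^k\rightrightarrows\mathbb R^k$ have a closed graph, put $H(x,y)=f(x,y)+Q(x,y)$ and $\Sigma(x)=\{y\mid 0\in H(x,y)\}$, and let $0\in H(\bar x,\bar y)$. Then $\Sigma$ is isolatedly calm around $(\bar x,\bar y)$ whenever one of the following two conditions holds. (i) For all $v\in\mathbb R^k$: $\;0\in\nabla_yf(\bar x,\bar y)v+D^\sharp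 Q\big((\bar x,\bar y),-f(\bar x,\bar y)\big)(0,v)\ \Rightarrow\ v=0$. (ii) $Q$ has the SCD property around $\big((\bar x,\bar y),-f(\bar x,\bar y)\big)$ and is semismooth$^*$ around $\big((\bar x,\bar y),-f(\bar x,\bar y)\big)$, and at least one of the following two implications holds: $$\big((0,v),-\nabla_yf(\bar x,\bar y)v\big)\in M\ \Rightarrow\ v=0\qquad\text{for all } M\in\mathcal SQ\big((\bar x,\bar y),-f(\bar x,\bar y)\big),$$ $$\big(w^*,(u^*,-\nabla_yf(\bar x,\bar y)^Tw^*)\big)\in M^*\ \Rightarrow\ w^*=0,\ u^*=0\qquad\text{for all } M^*\in\mathcal S^*Q\big((\bar x,\bar y),-f(\bar x,\bar y)\big).$$ Moreover, the two implications displayed in (ii) are equivalent. -/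

import Mathlib

open Filter Topology
open scoped Pointwise RealInnerProductSpace

namespace VarAnalysis

/-- The product of two Euclidean spaces with the norm `√(‖u‖² + ‖v‖²)`. -/
abbrev Prod2 (X Y : Type*) : Type _ := WithLp 2 (X × Y)

/-- The pair `(u, v)` as an element of the Euclidean product. -/
abbrev pair {X Y : Type*} (u : X) (v : Y) : Prod2 X Y := WithLp.toLp 2 (u, v)

/-- The graph `{(x, y) | y ∈ F x}` of a set-valued mapping. -/
def gph {X Y : Type*} (F : X → Set Y) : Set (Prod2 X Y) :=
  {p | p.snd ∈ F p.fst}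

section Cones

variable {E : Type*} [NormedAddCommGroup E] [InnerProductSpace ℝ E]

/-- The tangent (contingent, Bouligand) cone `Limsup_{t ↓ 0} (A - x) / t`. -/
def tangentCone (A : Set E) (x : E) : Set E :=
  {u | ∃ (t : ℕ → ℝ) (w : ℕ → E), (∀ k, 0 < t k) ∧ Tendsto t atTop (𝓝 0) ∧
    Tendsto w atTop (𝓝 u) ∧ ∀ k, x + t k • w k ∈ A}

/-- The outer limiting tangent cone `T^♯_A(x)`: the outer limit of the tangent cones
`T_A(x')` as `x' → x` within `A`. -/
def outerTangentCone (A : Set E) (x : E) : Set E :=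
  {u | ∃ (a : ℕ → E) (w : ℕ → E), (∀ k, a k ∈ A) ∧ Tendsto a atTop (𝓝 x) ∧
    Tendsto w atTop (𝓝 u) ∧ ∀ k, w k ∈ tangentCone A (a k)}

/-- The regular (Fréchet) normal cone: the negative polar of the tangent cone. -/
def regularNormalCone (A : Set E) (x : E) : Set E :=
  {xs | ∀ u ∈ tangentCone A x, ⟪xs, u⟫ ≤ 0}

end Cones

section Derivatives

variable {X Y : Type*} [NormedAddCommGroup X] [InnerProductSpace ℝ X]
  [NormedAddCommGroup Y] [InnerProductSpace ℝ Y]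

/-- The graphical derivative `DF(x, y) : X ⇉ Y`, with `p = (x, y)`. -/
def graphicalDeriv (F : X → Set Y) (p : Prod2 X Y) : X → Set Y :=
  fun u => {v | pair u v ∈ tangentCone (gph F) p}

/-- The outer limiting graphical derivative `D^♯F(x, y) : X ⇉ Y`, with `p = (x, y)`. -/
def outerGraphicalDeriv (F : X → Set Y) (p : Prod2 X Y) : X → Set Y :=
  fun u => {v | pair u v ∈ outerTangentCone (gph F) p}

/-- The regular (Fréchet) coderivative `D̂^*F(x, y) : Y ⇉ X`, with `p = (x, y)`. -/
def regularCoderiv (F : X → Set Y) (p : Prod2 X Y) : Y → Set X :=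
  fun ys => {xs | pair xs (-ys) ∈ regularNormalCone (gph F) p}

/-- `F` is semismooth* at `p = (x, y)`, a point of its graph. -/
def SemismoothStarAt (F : X → Set Y) (p : Prod2 X Y) : Prop :=
  p ∈ gph F ∧ ∀ ε > (0 : ℝ), ∃ δ > (0 : ℝ), ∀ q ∈ gph F, ‖q - p‖ ≤ δ →
    ∀ (ys : Y) (xs : X), xs ∈ regularCoderiv F q ys →
      |⟪xs, q.fst - p.fst⟫ - ⟪ys, q.snd - p.snd⟫| ≤ ε * ‖q - p‖ * ‖pair xs ys‖

/-- `F` is semismooth* on a neighborhood of `p`: at all points of its graph near `p`. -/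
def SemismoothStarAround (F : X → Set Y) (p : Prod2 X Y) : Prop :=
  ∃ W ∈ 𝓝 p, ∀ q ∈ gph F ∩ W, SemismoothStarAt F q

end Derivatives

section Subspaces

variable {X Y : Type*} [NormedAddCommGroup X] [InnerProductSpace ℝ X] [FiniteDimensional ℝ X]
  [NormedAddCommGroup Y] [InnerProductSpace ℝ Y] [FiniteDimensional ℝ Y]

/-- The distance `‖P₁ - P₂‖` between two subspaces, where `Pᵢ` is the orthogonal projection
onto `Lᵢ` and the norm is the operator norm. -/
noncomputable def subspaceDist (L₁ L₂ : Submodule ℝ (Prod2 X Y)) : ℝ :=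
  ‖L₁.starProjection - L₂.starProjection‖

/-- The set `𝒪_F` of the points of the graph at which `F` is graphically smooth of dimension
`dim X`: the tangent cone to the graph is a subspace of dimension `dim X`. -/
def graphicallySmoothPoints (F : X → Set Y) : Set (Prod2 X Y) :=
  {p | p ∈ gph F ∧ ∃ L : Submodule ℝ (Prod2 X Y),
    Module.finrank ℝ L = Module.finrank ℝ X ∧ (L : Set (Prod2 X Y)) = tangentCone (gph F) p}

/-- The SC limiting graphical derivative `𝒮F(p)`: the subspaces `L` of dimension `dim X` which
are limits of the subspaces `gph DF(p_k)` for some sequence `p_k → p` in `𝒪_F`. -/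
def scDeriv (F : X → Set Y) (p : Prod2 X Y) : Set (Submodule ℝ (Prod2 X Y)) :=
  {L | Module.finrank ℝ L = Module.finrank ℝ X ∧
    ∃ (q : ℕ → Prod2 X Y) (K : ℕ → Submodule ℝ (Prod2 X Y)),
      (∀ k, q k ∈ graphicallySmoothPoints F) ∧ Tendsto q atTop (𝓝 p) ∧
      (∀ k, (K k : Set (Prod2 X Y)) = gph (graphicalDeriv F (q k))) ∧
      Tendsto (fun k => subspaceDist L (K k)) atTop (𝓝 0)}

/-- The SC limiting coderivative `𝒮^*F(p)`: the subspaces `L^*` of dimension `dim Y` which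
are limits of the subspaces `gph D̂^*F(p_k)` for some sequence `p_k → p` in `𝒪_F`. -/
def scCoderiv (F : X → Set Y) (p : Prod2 X Y) : Set (Submodule ℝ (Prod2 Y X)) :=
  {L | Module.finrank ℝ L = Module.finrank ℝ Y ∧
    ∃ (q : ℕ → Prod2 X Y) (K : ℕ → Submodule ℝ (Prod2 Y X)),
      (∀ k, q k ∈ graphicallySmoothPoints F) ∧ Tendsto q atTop (𝓝 p) ∧
      (∀ k, (K k : Set (Prod2 Y X)) = gph (regularCoderiv F (q k))) ∧
      Tendsto (fun k => subspaceDist L (K k)) atTop (𝓝 0)}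

/-- The SCD property at a point of the graph. -/
def SCDAt (F : X → Set Y) (p : Prod2 X Y) : Prop :=
  p ∈ gph F ∧ (scCoderiv F p).Nonempty

/-- The SCD property around `p`: at all points of the graph near `p`. -/
def SCDAround (F : X → Set Y) (p : Prod2 X Y) : Prop :=
  ∃ W ∈ 𝓝 p, ∀ q ∈ gph F ∩ W, SCDAt F q

end Subspaces

section Calmness

variable {X Y : Type*} [NormedAddCommGroup X] [NormedAddCommGroup Y]

/-- `S` is isolatedly calm at `p = (x, y)`, a point of its graph, with constant `κ`:
`S(x') ∩ U ⊆ {y} + κ ‖x' - x‖ 𝓑` for all `x'`, with some neighborhood `U` of `y`. -/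
def IsolatedlyCalmAtWith (κ : ℝ) (S : X → Set Y) (p : Prod2 X Y) : Prop :=
  p ∈ gph S ∧ ∃ U ∈ 𝓝 p.snd, ∀ x' : X, S x' ∩ U ⊆ Metric.closedBall p.snd (κ * ‖x' - p.fst‖)

/-- `S` is isolatedly calm around `p`, a point of its graph: isolatedly calm, with one common
constant, at all points of its graph near `p`. -/
def IsolatedlyCalmAround (S : X → Set Y) (p : Prod2 X Y) : Prop :=
  p ∈ gph S ∧ ∃ κ ≥ (0 : ℝ), ∃ W ∈ 𝓝 p, ∀ q ∈ gph S ∩ W, IsolatedlyCalmAtWith κ S q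

end Calmness

section GeneralizedEquation

variable {X Y Z : Type*}

/-- The mapping `H(x, y) = f(x, y) + Q(x, y)`. -/
def geMap [Add Z] (f : Prod2 X Y → Z) (Q : Prod2 X Y → Set Z) : Prod2 X Y → Set Z :=
  fun p => {f p} + Q p

/-- The solution mapping `Σ(x) = {y | 0 ∈ H(x, y)}`. -/
def solutionMap [Zero Z] (H : Prod2 X Y → Set Z) : X → Set Y :=
  fun x => {y | 0 ∈ H (pair x y)}

/-- The partial derivative `∇_y f(x, y)`. -/
noncomputable def partialDerivY [NormedAddCommGroup Y] [NormedSpace ℝ Y]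
    [NormedAddCommGroup Z] [NormedSpace ℝ Z]
    (f : Prod2 X Y → Z) (x : X) (y : Y) : Y →L[ℝ] Z :=
  fderiv ℝ (fun y' => f (pair x y')) y

end GeneralizedEquation

end VarAnalysis

open VarAnalysis

/-! For (i), if calmness around the point fails, the constants `j + 1` fail at solutions tending to
it. Rescaling nearby solutions by the `y`-increment gives tangents `(u, v)` of the linearised
equation with `‖v‖ = 1` and `‖u‖ ≤ 1 / (j + 1)`; by compactness a limit `(0, v)` with `‖v‖ = 1`
solves the equation with `D^♯Q`.

Condition (ii) reduces to (i), because under SCD and semismoothness* every outer limiting tangent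
lies in some `M ∈ 𝒮Q` (`exists_mem_scDeriv_of_mem_outerTangentCone`): secants from a semismooth*
point to nearby graphically smooth points are almost tangent there, and the Grassmannian is compact.

The two implications in (ii) say `M ∩ V = 0` and `Mᗮ ∩ Vᗮ = 0` for `V = {((0, v), -∇_y f v)}`. As
`dim M + dim V` is the full dimension, both mean `M + V` is everything. -/

namespace VarAnalysis

/-! ### Compactness of the Grassmannian. -/

section SubspaceLimits

variable {E : Type*} [NormedAddCommGroup E] [InnerProductSpace ℝ E] [FiniteDimensional ℝ E]

lemma trace_starProjection (K : Submodule ℝ E) :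
    LinearMap.trace ℝ E (K.starProjection : E →ₗ[ℝ] E) = Module.finrank ℝ K := by
  refine LinearMap.IsProj.trace (p := K) ⟨fun x => K.starProjection_apply_mem x, fun x hx => ?_⟩
  exact K.starProjection_eq_self_iff.2 hx

/-- Sequential compactness of the set of `d`-dimensional subspaces, for the distance given by the
orthogonal projections. -/
lemma exists_subseq_tendsto_starProjection {d : ℕ} (K : ℕ → Submodule ℝ E)
    (hK : ∀ j, Module.finrank ℝ (K j) = d) :
    ∃ (M : Submodule ℝ E) (φ : ℕ → ℕ), Module.finrank ℝ M = d ∧ StrictMono φ ∧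
      Tendsto (fun j => (K (φ j)).starProjection) atTop (𝓝 M.starProjection) := by
  have : ProperSpace (E →L[ℝ] E) := FiniteDimensional.proper ℝ _
  obtain ⟨P, -, φ, hφ, hlim⟩ := (isCompact_closedBall (0 : E →L[ℝ] E) 1).tendsto_subseq
    (x := fun j => (K j).starProjection)
    fun j => by simpa using (K j).starProjection_norm_le
  -- Idempotence and self-adjointness are closed conditions, so the limit operator is again an
  -- orthogonal projection.
  have hP : IsStarProjection P := by
    refine ⟨?_, ?_⟩
    · refine tendsto_nhds_unique ((hlim.mul hlim).congr fun j => ?_) hlim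
      exact (K (φ j)).isIdempotentElem_starProjection
    · refine tendsto_nhds_unique (hlim.star.congr fun j => ?_) hlim
      exact isSelfAdjoint_starProjection (K (φ j))
  obtain ⟨M, hM, rfl⟩ := isStarProjection_iff_eq_starProjection.1 hP
  refine ⟨M, φ, ?_, hφ, hlim⟩
  -- The dimension is the trace of the projection, hence survives the limit.
  let τ : (E →L[ℝ] E) →ₗ[ℝ] ℝ := LinearMap.trace ℝ E ∘ₗ ContinuousLinearMap.coeLM ℝ
  have hτ : Continuous τ := LinearMap.continuous_of_finiteDimensional τ
  have h := (hτ.tendsto M.starProjection).comp hlim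
  have hc : ∀ j, τ ((K (φ j)).starProjection) = (d : ℝ) := fun j => by
    rw [← hK (φ j)]; exact trace_starProjection _
  have hm : τ M.starProjection = (Module.finrank ℝ M : ℝ) := trace_starProjection _
  rw [hm] at h
  have := tendsto_nhds_unique h (tendsto_const_nhds.congr fun j => (hc j).symm)
  exact_mod_cast this

end SubspaceLimits

/-! ### Duality between `𝒮F` and `𝒮^*F`. -/

section Duality

variable {X Y : Type*} [NormedAddCommGroup X] [InnerProductSpace ℝ X]
  [NormedAddCommGroup Y] [InnerProductSpace ℝ Y]

/-- The isometry `(y, x) ↦ (x, -y)`. -/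
noncomputable def swapNeg : Prod2 Y X ≃ₗᵢ[ℝ] Prod2 X Y where
  toFun p := pair p.snd (-p.fst)
  invFun p := pair (-p.snd) p.fst
  left_inv p := by simp only [WithLp.toLp_fst, WithLp.toLp_snd, neg_neg]; rfl
  right_inv p := by simp only [WithLp.toLp_fst, WithLp.toLp_snd, neg_neg]; rfl
  map_add' p q := by
    apply WithLp.ofLp_injective; ext <;> simp [add_comm]
  map_smul' c p := by
    apply WithLp.ofLp_injective; ext <;> simp
  norm_map' p := by
    simp [WithLp.prod_norm_eq_of_L2, add_comm]

lemma swapNeg_apply (p : Prod2 Y X) : swapNeg p = pair p.snd (-p.fst) := rfl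

/-- The subspace `{(y*, x*) | (x*, -y*) ∈ Lᗮ}`. -/
noncomputable def dualSubspace (L : Submodule ℝ (Prod2 X Y)) : Submodule ℝ (Prod2 Y X) :=
  Lᗮ.map ((swapNeg (X := X) (Y := Y)).symm.toLinearEquiv : Prod2 X Y →ₗ[ℝ] Prod2 Y X)

lemma mem_dualSubspace {L : Submodule ℝ (Prod2 X Y)} {p : Prod2 Y X} :
    p ∈ dualSubspace L ↔ pair p.snd (-p.fst) ∈ Lᗮ := by
  rw [← swapNeg_apply]
  constructor
  · rintro ⟨q, hq, rfl⟩
    simpa using hq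
  · intro h
    exact ⟨_, h, by simp⟩

lemma regularNormalCone_eq_orthogonal {E : Type*} [NormedAddCommGroup E] [InnerProductSpace ℝ E]
    {A : Set E} {x : E} {L : Submodule ℝ E} (hL : (L : Set E) = tangentCone A x) :
    regularNormalCone A x = Lᗮ := by
  ext n
  simp only [regularNormalCone, ← hL, SetLike.mem_coe, Set.mem_ofPred_eq,
    Submodule.mem_orthogonal']
  refine ⟨fun h u hu => le_antisymm (h u hu) ?_, fun h u hu => (h u hu).le⟩
  simpa using h (-u) (L.neg_mem hu)

lemma gph_regularCoderiv_eq_dualSubspace {F : X → Set Y} {p : Prod2 X Y}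
    {L : Submodule ℝ (Prod2 X Y)} (hL : (L : Set (Prod2 X Y)) = tangentCone (gph F) p) :
    gph (regularCoderiv F p) = dualSubspace L := by
  ext q
  rw [SetLike.mem_coe, mem_dualSubspace]
  change pair q.snd (-q.fst) ∈ regularNormalCone (gph F) p ↔ _
  rw [regularNormalCone_eq_orthogonal hL, SetLike.mem_coe]

variable [FiniteDimensional ℝ X] [FiniteDimensional ℝ Y]

lemma dualSubspace_surjective :
    Function.Surjective (dualSubspace : Submodule ℝ (Prod2 X Y) → Submodule ℝ (Prod2 Y X)) := by
  intro M
  refine ⟨(M.map ((swapNeg (X := X) (Y := Y)).toLinearEquiv : Prod2 Y X →ₗ[ℝ] Prod2 X Y))ᗮ, ?_⟩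
  ext p
  rw [mem_dualSubspace, Submodule.orthogonal_orthogonal, ← swapNeg_apply]
  constructor
  · rintro ⟨q, hq, h⟩
    have : q = p := swapNeg.injective h
    rwa [← this]
  · intro h
    exact ⟨p, h, rfl⟩

lemma finrank_prod2 :
    Module.finrank ℝ (Prod2 X Y) = Module.finrank ℝ X + Module.finrank ℝ Y := by
  rw [(WithLp.linearEquiv 2 ℝ (X × Y)).finrank_eq, Module.finrank_prod]

lemma finrank_dualSubspace_iff {L : Submodule ℝ (Prod2 X Y)} :
    Module.finrank ℝ (dualSubspace L) = Module.finrank ℝ Y ↔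
      Module.finrank ℝ L = Module.finrank ℝ X := by
  have h1 : Module.finrank ℝ (dualSubspace L) = Module.finrank ℝ Lᗮ :=
    LinearEquiv.finrank_map_eq _ _
  have h2 := L.finrank_add_finrank_orthogonal
  rw [finrank_prod2] at h2
  omega

/-- Passing to complements only flips the sign of `P₁ - P₂`, and conjugation by an isometry keeps
its norm. -/
lemma subspaceDist_dualSubspace (L M : Submodule ℝ (Prod2 X Y)) :
    subspaceDist (dualSubspace L) (dualSubspace M) = subspaceDist L M := by
  have key : ∀ p, ((dualSubspace L).starProjection - (dualSubspace M).starProjection) p =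
      -swapNeg.symm ((L.starProjection - M.starProjection) (swapNeg p)) := fun p => by
    simp only [dualSubspace, sub_apply, Submodule.starProjection_map_apply,
      Submodule.starProjection_orthogonal_val, LinearIsometryEquiv.symm_symm, map_sub]
    abel
  unfold subspaceDist
  refine le_antisymm (ContinuousLinearMap.opNorm_le_bound _ (norm_nonneg _) fun p => ?_)
    (ContinuousLinearMap.opNorm_le_bound _ (norm_nonneg _) fun p => ?_)
  · rw [key, norm_neg, LinearIsometryEquiv.norm_map]
    simpa using (L.starProjection - M.starProjection).le_opNorm (swapNeg p)
  · have := ((dualSubspace L).starProjection - (dualSubspace M).starProjection).le_opNorm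
      (swapNeg.symm p)
    rwa [key, norm_neg, LinearIsometryEquiv.norm_map, LinearIsometryEquiv.norm_map,
      LinearIsometryEquiv.apply_symm_apply] at this

/-- At graphically smooth points the coderivative graph is the dual of the tangent space, and
duality preserves distances, so convergent sequences correspond. -/
lemma scCoderiv_eq_image_dualSubspace (F : X → Set Y) (p : Prod2 X Y) :
    scCoderiv F p = dualSubspace '' scDeriv F p := by
  ext Ms
  constructor
  · rintro ⟨hd, q, K, hq, hqp, hK, hlim⟩
    obtain ⟨M, rfl⟩ := dualSubspace_surjective Ms
    choose L _ hL using fun j => (hq j).2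
    have hKL : ∀ j, K j = dualSubspace (L j) := fun j =>
      SetLike.coe_injective ((hK j).trans (gph_regularCoderiv_eq_dualSubspace (hL j)))
    refine ⟨M, ⟨finrank_dualSubspace_iff.1 hd, q, L, hq, hqp, hL, ?_⟩, rfl⟩
    simpa only [hKL, subspaceDist_dualSubspace] using hlim
  · rintro ⟨M, ⟨hd, q, K, hq, hqp, hK, hlim⟩, rfl⟩
    refine ⟨finrank_dualSubspace_iff.2 hd, q, fun j => dualSubspace (K j), hq, hqp,
      fun j => (gph_regularCoderiv_eq_dualSubspace (hK j)).symm, ?_⟩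
    simpa only [subspaceDist_dualSubspace] using hlim

end Duality

/-! ### Outer limiting tangents under SCD and semismoothness*. -/

section SemismoothStar

variable {X Y : Type*} [NormedAddCommGroup X] [InnerProductSpace ℝ X] [FiniteDimensional ℝ X]
  [NormedAddCommGroup Y] [InnerProductSpace ℝ Y] [FiniteDimensional ℝ Y]

lemma SCDAt.mem_closure {F : X → Set Y} {p : Prod2 X Y} (h : SCDAt F p) :
    p ∈ closure (graphicallySmoothPoints F) := by
  obtain ⟨-, L, -, q, K, hq, hqp, -⟩ := h
  exact mem_closure_of_tendsto hqp (Eventually.of_forall hq)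

/-- Test the semismooth* inequality with the normal `n` that is the projection of `q - p` itself:
then `⟪n, q - p⟫ = ‖n‖ ^ 2`, and one factor `‖n‖` cancels. -/
lemma SemismoothStarAt.norm_starProjection_orthogonal_le {F : X → Set Y} {p : Prod2 X Y}
    (h : SemismoothStarAt F p) {ε : ℝ} (hε : 0 < ε) :
    ∃ δ > (0 : ℝ), ∀ q ∈ gph F, ‖q - p‖ ≤ δ → ∀ K : Submodule ℝ (Prod2 X Y),
      (K : Set (Prod2 X Y)) = tangentCone (gph F) q →
        ‖Kᗮ.starProjection (q - p)‖ ≤ ε * ‖q - p‖ := by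
  obtain ⟨δ, hδ, H⟩ := h.2 ε hε
  refine ⟨δ, hδ, fun q hq hqp K hK => ?_⟩
  set n := Kᗮ.starProjection (q - p) with hn
  have hnK : n ∈ Kᗮ := Kᗮ.starProjection_apply_mem _
  have hmem : n.fst ∈ regularCoderiv F q (-n.snd) := by
    change pair n.fst (- -n.snd) ∈ regularNormalCone (gph F) q
    rw [regularNormalCone_eq_orthogonal hK, neg_neg]
    exact hnK
  have h1 := H q hq hqp _ _ hmem
  have h2 : ⟪n.fst, q.fst - p.fst⟫ - ⟪-n.snd, q.snd - p.snd⟫ = ⟪n, q - p⟫ := by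
    rw [inner_neg_left, sub_neg_eq_add]; rfl
  have h3 : ⟪n, q - p⟫ = ‖n‖ * ‖n‖ := by
    rw [← real_inner_self_eq_norm_mul_norm]
    conv_rhs => rw [hn, Submodule.inner_starProjection_left_eq_right,
      Submodule.starProjection_eq_self_iff.2 hnK, real_inner_comm]
  have h4 : ‖pair n.fst (-n.snd)‖ = ‖n‖ := by
    simp [WithLp.prod_norm_eq_of_L2]
  rw [h2, h3, h4, abs_of_nonneg (by positivity)] at h1
  rcases (norm_nonneg n).eq_or_lt with h0 | h0
  · rw [← h0]; positivity
  · exact le_of_mul_le_mul_right h1 h0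

/-- A tangent direction at a point where `F` is semismooth* is almost contained in a tangent
subspace at a nearby graphically smooth point. -/
lemma SemismoothStarAt.exists_graphicallySmoothPoint {F : X → Set Y} {p : Prod2 X Y}
    (h : SemismoothStarAt F p)
    (hd : ∀ᶠ a in 𝓝 p, a ∈ gph F → a ∈ closure (graphicallySmoothPoints F))
    {w : Prod2 X Y} (hw : w ∈ tangentCone (gph F) p) {η : ℝ} (hη : 0 < η) :
    ∃ q ∈ graphicallySmoothPoints F, ‖q - p‖ < η ∧ ∃ K : Submodule ℝ (Prod2 X Y),
      Module.finrank ℝ K = Module.finrank ℝ X ∧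
      (K : Set (Prod2 X Y)) = tangentCone (gph F) q ∧ ‖Kᗮ.starProjection w‖ ≤ η := by
  obtain ⟨t, v, ht0, ht, hv, hA⟩ := hw
  -- `μ` will bound `‖w - z‖` for the secant `z`: the `1` yields `‖z‖ ≤ ‖w‖ + 1`, for which `ε` is
  -- tuned so that `ε * ‖z‖ ≤ η / 2`.
  set μ := min 1 (η / 2) with hμ
  have hμ0 : 0 < μ := by positivity
  set ε := η / (2 * (‖w‖ + 1)) with hε
  have hε0 : 0 < ε := by positivity
  obtain ⟨δ, hδ, H⟩ := h.norm_starProjection_orthogonal_le hε0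
  set ρ := min δ η with hρ
  have hρ0 : 0 < ρ := by positivity
  have htv : Tendsto (fun j => t j • v j) atTop (𝓝 0) := by simpa using ht.smul hv
  have htp : Tendsto (fun j => p + t j • v j) atTop (𝓝 p) := by
    simpa using tendsto_const_nhds.add htv
  have e1 : ∀ᶠ j in atTop, ‖t j • v j‖ < ρ / 2 := by
    have := htv.norm
    rw [norm_zero] at this
    exact this.eventually_lt_const (by positivity)
  have e2 : ∀ᶠ j in atTop, dist (v j) w < μ / 2 := Metric.tendsto_nhds.1 hv _ (by positivity)
  obtain ⟨j, h1, h2, h3⟩ := (e1.and (e2.and (htp.eventually hd))).exists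
  have hcl := h3 (hA j)
  have htj := ht0 j
  -- The error must be small relative to `t j`, since it is later divided by `t j`.
  obtain ⟨q, hq, hqa⟩ := Metric.mem_closure_iff.1 hcl (min (t j * (μ / 2)) (ρ / 2))
    (by positivity)
  rw [dist_comm, dist_eq_norm] at hqa
  have hqa1 := hqa.trans_le (min_le_left _ _)
  have hqa2 := hqa.trans_le (min_le_right _ _)
  have hqp : ‖q - p‖ < ρ := by
    have : q - p = (q - (p + t j • v j)) + t j • v j := by abel
    rw [this]
    linarith [norm_add_le (q - (p + t j • v j)) (t j • v j)]
  obtain ⟨K, hKd, hK⟩ := hq.2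
  refine ⟨q, hq, hqp.trans_le (min_le_right _ _), K, hKd, hK, ?_⟩
  have hn := H q hq.1 (hqp.le.trans (min_le_left _ _)) K hK
  set z := (t j)⁻¹ • (q - p) with hz
  have hzw : ‖w - z‖ ≤ μ := by
    have e : w - z = -((t j)⁻¹ • (q - (p + t j • v j)) + (v j - w)) := by
      simp only [hz, smul_sub, smul_add, smul_smul, inv_mul_cancel₀ htj.ne', one_smul]
      abel
    have e' : ‖(t j)⁻¹ • (q - (p + t j • v j))‖ ≤ μ / 2 := by
      rw [norm_smul, norm_inv, Real.norm_of_nonneg htj.le, inv_mul_le_iff₀ htj]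
      exact hqa1.le
    rw [dist_eq_norm] at h2
    rw [e, norm_neg]
    linarith [norm_add_le ((t j)⁻¹ • (q - (p + t j • v j))) (v j - w)]
  have hz1 : ‖z‖ ≤ ‖w‖ + 1 := by
    have : z = w - (w - z) := by abel
    rw [this]
    linarith [norm_sub_le w (w - z), min_le_left (1 : ℝ) (η / 2)]
  have hPz : ‖Kᗮ.starProjection z‖ ≤ ε * ‖z‖ := by
    rw [hz, map_smul, norm_smul, norm_smul, mul_left_comm]
    gcongr
  have hPwz : ‖Kᗮ.starProjection (w - z)‖ ≤ μ := by
    refine ((Kᗮ.starProjection).le_opNorm _).trans ?_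
    calc _ ≤ 1 * ‖w - z‖ := by gcongr; exact Kᗮ.starProjection_norm_le
      _ ≤ μ := by rwa [one_mul]
  have hεz : ε * ‖z‖ ≤ η / 2 := by
    calc ε * ‖z‖ ≤ ε * (‖w‖ + 1) := by gcongr
      _ = η / 2 := by rw [hε]; field_simp
  have hsplit : Kᗮ.starProjection w = Kᗮ.starProjection z + Kᗮ.starProjection (w - z) := by
    rw [← map_add]; congr 1; abel
  rw [hsplit]
  linarith [norm_add_le (Kᗮ.starProjection z) (Kᗮ.starProjection (w - z)),
    min_le_right (1 : ℝ) (η / 2)]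

/-- Under the SCD property and semismoothness* around `p`, every outer limiting tangent direction
lies in one of the subspaces of the SC limiting graphical derivative. -/
theorem exists_mem_scDeriv_of_mem_outerTangentCone {F : X → Set Y} {p : Prod2 X Y}
    (hscd : SCDAround F p) (hss : SemismoothStarAround F p) {w : Prod2 X Y}
    (hw : w ∈ outerTangentCone (gph F) p) : ∃ M ∈ scDeriv F p, w ∈ M := by
  obtain ⟨W₁, hW₁, hscd⟩ := hscd
  obtain ⟨W₂, hW₂, hss⟩ := hss
  obtain ⟨a, v, haF, ha, hv, hva⟩ := hw
  -- SCD is needed at all graph points near `a j`, semismoothness* only at `a j`.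
  have hev : ∀ᶠ j in atTop, W₁ ∈ 𝓝 (a j) ∧ a j ∈ W₂ :=
    (ha.eventually (eventually_mem_nhds_iff.2 hW₁)).and (ha hW₂)
  obtain ⟨N, hN⟩ := eventually_atTop.1 hev
  have hη : ∀ j : ℕ, (0 : ℝ) < 1 / ((j : ℝ) + 1) := fun j => Nat.one_div_pos_of_nat
  have hex : ∀ j : ℕ, ∃ q ∈ graphicallySmoothPoints F, ‖q - a (j + N)‖ < 1 / ((j : ℝ) + 1) ∧
      ∃ K : Submodule ℝ (Prod2 X Y), Module.finrank ℝ K = Module.finrank ℝ X ∧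
        (K : Set (Prod2 X Y)) = tangentCone (gph F) q ∧
        ‖Kᗮ.starProjection (v (j + N))‖ ≤ 1 / ((j : ℝ) + 1) := fun j => by
    obtain ⟨h1, h2⟩ := hN (j + N) (Nat.le_add_left _ _)
    refine (hss _ ⟨haF _, h2⟩).exists_graphicallySmoothPoint ?_ (hva _) (hη j)
    filter_upwards [h1] with b hb hbF using (hscd b ⟨hbF, hb⟩).mem_closure
  choose q hq hqa K hKd hK hKv using hex
  obtain ⟨M, φ, hMd, hφ, hlim⟩ := exists_subseq_tendsto_starProjection K hKd
  have hto : Tendsto (fun j : ℕ => 1 / ((j : ℝ) + 1)) atTop (𝓝 0) :=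
    tendsto_one_div_add_atTop_nhds_zero_nat
  have hqp : Tendsto q atTop (𝓝 p) := by
    have h1 : Tendsto (fun j => q j - a (j + N)) atTop (𝓝 0) :=
      squeeze_zero_norm (fun j => (hqa j).le) hto
    simpa using h1.add (ha.comp (tendsto_add_atTop_nat N))
  refine ⟨M, ⟨hMd, q ∘ φ, K ∘ φ, fun j => hq _, hqp.comp hφ.tendsto_atTop, fun j => hK _, ?_⟩, ?_⟩
  · simpa [subspaceDist] using (tendsto_const_nhds (x := M.starProjection)).sub hlim |>.norm
  · have h1 : Tendsto (fun j => (K (φ j))ᗮ.starProjection (v (φ j + N))) atTop (𝓝 0) :=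
      squeeze_zero_norm (fun j => hKv (φ j)) (hto.comp hφ.tendsto_atTop)
    have hvφ : Tendsto (fun j => v (φ j + N)) atTop (𝓝 w) :=
      hv.comp ((tendsto_add_atTop_nat N).comp hφ.tendsto_atTop)
    have h2 : Tendsto (fun j => (K (φ j))ᗮ.starProjection (v (φ j + N))) atTop
        (𝓝 (w - M.starProjection w)) := by
      simp only [Submodule.starProjection_orthogonal_val]
      exact hvφ.sub ((isBoundedBilinearMap_apply.continuous.tendsto (M.starProjection, w)).comp
        (hlim.prodMk_nhds hvφ))
    have h3 := tendsto_nhds_unique h2 h1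
    exact Submodule.starProjection_eq_self_iff.1 (sub_eq_zero.1 h3).symm

end SemismoothStar

/-! ### Equivalence of the primal and dual conditions. -/

section Transversality

variable {X Y Z : Type*} [NormedAddCommGroup X] [InnerProductSpace ℝ X]
  [NormedAddCommGroup Y] [InnerProductSpace ℝ Y] [NormedAddCommGroup Z] [InnerProductSpace ℝ Z]

/-- For complementary dimensions, trivial intersection is equivalent to `M ⊔ V = ⊤`, and `Mᗮ ⊓ Vᗮ =
(M ⊔ V)ᗮ`. -/
lemma disjoint_iff_disjoint_orthogonal {E : Type*} [NormedAddCommGroup E] [InnerProductSpace ℝ E]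
    [FiniteDimensional ℝ E] {M V : Submodule ℝ E}
    (h : Module.finrank ℝ M + Module.finrank ℝ V = Module.finrank ℝ E) :
    Disjoint M V ↔ Disjoint Mᗮ Vᗮ := by
  rw [disjoint_iff (a := Mᗮ), Submodule.inf_orthogonal, Submodule.orthogonal_eq_bot_iff]
  refine ⟨Submodule.eq_top_of_disjoint M V h.ge, fun hs => ?_⟩
  have := M.finrank_sup_add_finrank_inf_eq V
  rw [hs, finrank_top, h] at this
  rw [disjoint_iff]
  exact Submodule.finrank_eq_zero.1 (by omega)

/-- The linear map `v ↦ ((0, v), -A v)`. -/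
noncomputable def verticalGraph (X : Type*) [NormedAddCommGroup X] [InnerProductSpace ℝ X]
    (A : Y →L[ℝ] Z) : Y →ₗ[ℝ] Prod2 (Prod2 X Y) Z where
  toFun v := pair (pair 0 v) (-A v)
  map_add' u v := by
    rw [← WithLp.toLp_add, Prod.mk_add_mk, ← WithLp.toLp_add, Prod.mk_add_mk, add_zero, map_add,
      neg_add]
  map_smul' c v := by
    rw [RingHom.id_apply, ← WithLp.toLp_smul, Prod.smul_mk, ← WithLp.toLp_smul, Prod.smul_mk,
      smul_zero, map_smul, smul_neg]

lemma verticalGraph_injective (A : Y →L[ℝ] Z) : Function.Injective (verticalGraph X A) :=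
  fun _ _ h => congrArg (fun p : Prod2 (Prod2 X Y) Z => p.fst.snd) h

lemma disjoint_range_verticalGraph_iff (A : Y →L[ℝ] Z) {M : Submodule ℝ (Prod2 (Prod2 X Y) Z)} :
    Disjoint M (LinearMap.range (verticalGraph X A)) ↔
      ∀ v : Y, pair (pair 0 v) (-A v) ∈ M → v = 0 := by
  rw [Submodule.disjoint_def]
  refine ⟨fun h v hv => ?_, ?_⟩
  · exact verticalGraph_injective A ((h _ hv ⟨v, rfl⟩).trans (map_zero _).symm)
  · rintro h _ hM ⟨v, rfl⟩
    rw [h v hM, map_zero]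

variable [FiniteDimensional ℝ Y] [FiniteDimensional ℝ Z]

lemma mem_range_verticalGraph_orthogonal (A : Y →L[ℝ] Z) {n : Prod2 (Prod2 X Y) Z} :
    n ∈ (LinearMap.range (verticalGraph X A))ᗮ ↔ n.fst.snd = A.adjoint n.snd := by
  have key : ∀ v, ⟪n, verticalGraph X A v⟫ = ⟪n.fst.snd - A.adjoint n.snd, v⟫ := fun v => by
    rw [inner_sub_left, ContinuousLinearMap.adjoint_inner_left]
    change (⟪n.fst.fst, 0⟫ + ⟪n.fst.snd, v⟫) + ⟪n.snd, -A v⟫ = _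
    rw [inner_zero_right, inner_neg_right]
    ring
  rw [Submodule.mem_orthogonal']
  refine ⟨fun h => ?_, ?_⟩
  · have h1 := h _ ⟨n.fst.snd - A.adjoint n.snd, rfl⟩
    rw [key] at h1
    exact sub_eq_zero.1 (inner_self_eq_zero.1 h1)
  · rintro h _ ⟨v, rfl⟩
    rw [key, h, sub_self, inner_zero_left]

lemma disjoint_orthogonal_iff_dualSubspace (A : Y →L[ℝ] Z)
    {M : Submodule ℝ (Prod2 (Prod2 X Y) Z)} :
    Disjoint Mᗮ (LinearMap.range (verticalGraph X A))ᗮ ↔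
      ∀ (ws : Z) (us : X), pair ws (pair us (-A.adjoint ws)) ∈ dualSubspace M →
        ws = 0 ∧ us = 0 := by
  rw [Submodule.disjoint_def]
  refine ⟨fun h ws us hM => ?_, fun h n hn hnV => ?_⟩
  · have h0 := h _ (mem_dualSubspace.1 hM)
      ((mem_range_verticalGraph_orthogonal A).2 (map_neg A.adjoint ws).symm)
    exact ⟨neg_eq_zero.1 (congrArg (fun p : Prod2 (Prod2 X Y) Z => p.snd) h0),
      congrArg (fun p : Prod2 (Prod2 X Y) Z => p.fst.fst) h0⟩
  · rw [mem_range_verticalGraph_orthogonal] at hnV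
    -- The sign in `swapNeg` forces `ws = -n.snd`.
    have hn' : n = pair (pair n.fst.fst (-A.adjoint (-n.snd))) (- -n.snd) := by
      rw [map_neg, neg_neg, neg_neg, ← hnV]; rfl
    have h0 := h (-n.snd) n.fst.fst (mem_dualSubspace.2 (by rw [hn'] at hn; exact hn))
    rw [hn', h0.1, h0.2, map_zero, neg_zero, neg_zero]
    rfl

variable [FiniteDimensional ℝ X]

/-- The primal and the dual nondegeneracy conditions on the SC limiting derivatives agree. -/
theorem forall_scDeriv_iff_forall_scCoderiv
    (hYZ : Module.finrank ℝ Y = Module.finrank ℝ Z) (Q : Prod2 X Y → Set Z)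
    (p : Prod2 (Prod2 X Y) Z) (A : Y →L[ℝ] Z) :
    (∀ M ∈ scDeriv Q p, ∀ v : Y, pair (pair 0 v) (-A v) ∈ M → v = 0) ↔
      ∀ Ms ∈ scCoderiv Q p, ∀ (ws : Z) (us : X),
        pair ws (pair us (-A.adjoint ws)) ∈ Ms → ws = 0 ∧ us = 0 := by
  rw [scCoderiv_eq_image_dualSubspace, Set.forall_mem_image]
  refine forall₂_congr fun M hM => ?_
  rw [← disjoint_range_verticalGraph_iff, ← disjoint_orthogonal_iff_dualSubspace]
  refine disjoint_iff_disjoint_orthogonal ?_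
  rw [hM.1, LinearMap.finrank_range_of_inj (verticalGraph_injective (X := X) A),
    hYZ]
  exact finrank_prod2.symm

end Transversality

/-! ### Isolated calmness from the outer limiting derivative. -/

section Calmness

variable {X Y Z : Type*}

lemma zero_mem_geMap_iff [AddGroup Z] {f : Prod2 X Y → Z} {Q : Prod2 X Y → Set Z} {p : Prod2 X Y} :
    (0 : Z) ∈ geMap f Q p ↔ pair p (-f p) ∈ gph Q := by
  change (0 : Z) ∈ {f p} + Q p ↔ -f p ∈ Q p
  rw [Set.singleton_add, Set.mem_image]
  refine ⟨?_, fun h => ⟨_, h, add_neg_cancel _⟩⟩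
  rintro ⟨z, hz, h⟩
  rwa [← eq_neg_of_add_eq_zero_right h]

lemma mem_gph_solutionMap [AddGroup Z] {f : Prod2 X Y → Z} {Q : Prod2 X Y → Set Z} {p : Prod2 X Y} :
    p ∈ gph (solutionMap (geMap f Q)) ↔ pair p (-f p) ∈ gph Q :=
  zero_mem_geMap_iff

variable [NormedAddCommGroup X] [InnerProductSpace ℝ X] [NormedAddCommGroup Y]
  [InnerProductSpace ℝ Y] [NormedAddCommGroup Z] [InnerProductSpace ℝ Z]

lemma partialDerivY_apply {f : Prod2 X Y → Z} {x : X} {y : Y}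
    (hf : DifferentiableAt ℝ f (pair x y)) (v : Y) :
    partialDerivY f x y v = fderiv ℝ f (pair x y) (pair 0 v) := by
  let e := (WithLp.prodContinuousLinearEquiv 2 ℝ X Y).symm
  have h1 : HasFDerivAt (fun y' : Y => pair x y')
      ((e : X × Y →L[ℝ] Prod2 X Y).comp (ContinuousLinearMap.inr ℝ X Y)) y :=
    e.hasFDerivAt.comp y (hasFDerivAt_prodMk_right x y)
  have h2 := hf.hasFDerivAt.comp y h1
  have h3 : partialDerivY f x y = _ := h2.fderiv
  rw [h3]
  rfl

variable [FiniteDimensional ℝ X] [FiniteDimensional ℝ Y]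

/-- If the solution mapping is not isolatedly calm with constant `κ` at a point of its graph, then
the linearised generalised equation there has a solution `(u, v)` with `‖v‖ = 1`, `κ‖u‖ ≤ 1`. -/
lemma exists_tangent_of_not_isolatedlyCalmAtWith {f : Prod2 X Y → Z} {Q : Prod2 X Y → Set Z}
    {p : Prod2 X Y} {κ : ℝ} (hκ : 0 < κ) (hf : DifferentiableAt ℝ f p)
    (hp : p ∈ gph (solutionMap (geMap f Q)))
    (h : ¬ IsolatedlyCalmAtWith κ (solutionMap (geMap f Q)) p) :
    ∃ d : Prod2 X Y, ‖d.snd‖ = 1 ∧ κ * ‖d.fst‖ ≤ 1 ∧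
      pair d (-fderiv ℝ f p d) ∈ tangentCone (gph Q) (pair p (-f p)) := by
  -- Only the `y`-increment is localised; the strict inequality then forces the `x`-increment to be
  -- small too.
  have hex : ∀ j : ℕ, ∃ q : Prod2 X Y, q ∈ gph (solutionMap (geMap f Q)) ∧
      ‖q.snd - p.snd‖ < 1 / ((j : ℝ) + 1) ∧ κ * ‖q.fst - p.fst‖ < ‖q.snd - p.snd‖ := by
    intro j
    by_contra hc
    push Not at hc
    refine h ⟨hp, Metric.ball p.snd (1 / ((j : ℝ) + 1)),
      Metric.ball_mem_nhds _ Nat.one_div_pos_of_nat, fun x' y' hy' => ?_⟩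
    have hb := hy'.2
    rw [Metric.mem_ball, dist_eq_norm] at hb
    rw [Metric.mem_closedBall, dist_eq_norm]
    exact hc (pair x' y') hy'.1 hb
  choose q hq hq1 hq2 using hex
  set t : ℕ → ℝ := fun j => ‖(q j).snd - p.snd‖ with ht
  have ht0 : ∀ j, 0 < t j := fun j =>
    (mul_nonneg hκ.le (norm_nonneg _)).trans_lt (hq2 j)
  have htl : Tendsto t atTop (𝓝 0) :=
    squeeze_zero (fun j => (ht0 j).le) (fun j => (hq1 j).le)
      tendsto_one_div_add_atTop_nhds_zero_nat
  set w : ℕ → Prod2 X Y := fun j => (t j)⁻¹ • (q j - p) with hw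
  have hws : ∀ j, ‖(w j).snd‖ = 1 := fun j => by
    change ‖(t j)⁻¹ • ((q j).snd - p.snd)‖ = 1
    rw [norm_smul, norm_inv, Real.norm_of_nonneg (ht0 j).le]
    exact inv_mul_cancel₀ (ht0 j).ne'
  have hwf : ∀ j, κ * ‖(w j).fst‖ ≤ 1 := fun j => by
    change κ * ‖(t j)⁻¹ • ((q j).fst - p.fst)‖ ≤ 1
    rw [norm_smul, norm_inv, Real.norm_of_nonneg (ht0 j).le, mul_left_comm,
      inv_mul_le_iff₀ (ht0 j), mul_one]
    exact (hq2 j).le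
  have hwb : ∀ j, w j ∈ Metric.closedBall (0 : Prod2 X Y) (κ⁻¹ + 1) := fun j => by
    rw [mem_closedBall_zero_iff, WithLp.prod_norm_eq_of_L2, hws]
    have h1 : ‖(w j).fst‖ ≤ κ⁻¹ := by
      rw [← one_div, le_div_iff₀' hκ]; exact hwf j
    rw [Real.sqrt_le_left (by positivity)]
    nlinarith [norm_nonneg (w j).fst, inv_pos.2 hκ]
  have : ProperSpace (Prod2 X Y) := FiniteDimensional.proper ℝ _
  obtain ⟨d, -, φ, hφ, hd⟩ := (isCompact_closedBall (0 : Prod2 X Y) (κ⁻¹ + 1)).tendsto_subseq hwb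
  have hcf : Continuous fun z : Prod2 X Y => ‖z.fst‖ := by fun_prop
  have hcs : Continuous fun z : Prod2 X Y => ‖z.snd‖ := by fun_prop
  have htφ : Tendsto (t ∘ φ) atTop (𝓝 0) := htl.comp hφ.tendsto_atTop
  refine ⟨d, ?_, ?_, ?_⟩
  · exact tendsto_nhds_unique ((hcs.tendsto d).comp hd)
      (tendsto_const_nhds.congr fun j => (hws (φ j)).symm)
  · exact le_of_tendsto (((hcf.tendsto d).comp hd).const_mul κ)
      (Eventually.of_forall fun j => hwf (φ j))
  · have hstep : ∀ j, t j • w j = q j - p := fun j => by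
      rw [hw, smul_smul, mul_inv_cancel₀ (ht0 j).ne', one_smul]
    have h0 : Tendsto (fun j => q (φ j) - p) atTop (𝓝 0) := by
      have := htφ.smul hd
      rw [zero_smul] at this
      exact this.congr fun j => hstep (φ j)
    have hlim : Tendsto (fun j => (t (φ j))⁻¹ • (f (p + (q (φ j) - p)) - f p)) atTop
        (𝓝 (fderiv ℝ f p d)) :=
      hf.hasFDerivAt.hasFDerivWithinAt.lim (s := Set.univ) h0
        (Eventually.of_forall fun _ => Set.mem_univ _) hd
    -- Using the difference quotient of `f` instead of its derivative makes the perturbed points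
    -- exactly `(q, -f q)`, which lie in the graph of `Q`.
    refine ⟨t ∘ φ, fun j => pair (w (φ j)) (-((t (φ j))⁻¹ • (f (p + (q (φ j) - p)) - f p))),
      fun j => ht0 _, htφ, ?_, fun j => ?_⟩
    · exact ((WithLp.prod_continuous_toLp 2 _ _).tendsto _).comp (hd.prodMk_nhds hlim.neg)
    · have e : pair p (-f p) + (t ∘ φ) j •
          pair (w (φ j)) (-((t (φ j))⁻¹ • (f (p + (q (φ j) - p)) - f p))) =
          pair (q (φ j)) (-f (q (φ j))) := by
        rw [← WithLp.toLp_smul, Prod.smul_mk, ← WithLp.toLp_add, Prod.mk_add_mk,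
          Function.comp_apply, hstep, smul_neg, smul_smul, mul_inv_cancel₀ (ht0 _).ne', one_smul,
          add_sub_cancel]
        congr 2
        abel
      rw [e]
      exact mem_gph_solutionMap.1 (hq (φ j))

/-- Isolated calmness around a point from the outer limiting graphical derivative. -/
theorem isolatedlyCalmAround_of_outerTangentCone {f : Prod2 X Y → Z} {Q : Prod2 X Y → Set Z}
    {p : Prod2 X Y} (hf : ContDiff ℝ 1 f) (hp : p ∈ gph (solutionMap (geMap f Q)))
    (h : ∀ v : Y, pair (pair 0 v) (-fderiv ℝ f p (pair 0 v)) ∈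
      outerTangentCone (gph Q) (pair p (-f p)) → v = 0) :
    IsolatedlyCalmAround (solutionMap (geMap f Q)) p := by
  by_contra hcalm
  have hex : ∀ j : ℕ, ∃ q ∈ gph (solutionMap (geMap f Q)) ∩ Metric.ball p (1 / ((j : ℝ) + 1)),
      ∃ d : Prod2 X Y, ‖d.snd‖ = 1 ∧ ‖d.fst‖ ≤ 1 / ((j : ℝ) + 1) ∧
        pair d (-fderiv ℝ f q d) ∈ tangentCone (gph Q) (pair q (-f q)) := by
    intro j
    have hj : (0 : ℝ) < (j : ℝ) + 1 := by positivity
    by_contra hc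
    -- The constant grows while the ball shrinks, which forces both `q → p` and `d.fst → 0`.
    refine hcalm ⟨hp, (j : ℝ) + 1, hj.le, Metric.ball p (1 / ((j : ℝ) + 1)),
      Metric.ball_mem_nhds _ (by positivity), fun q hq => ?_⟩
    by_contra hqc
    obtain ⟨d, hd1, hd2, hd3⟩ := exists_tangent_of_not_isolatedlyCalmAtWith hj
      (hf.differentiable one_ne_zero q) hq.1 hqc
    exact hc ⟨q, hq, d, hd1, (le_div_iff₀' hj).2 hd2, hd3⟩
  choose q hq d hd1 hd2 hd3 using hex
  have hto : Tendsto (fun j : ℕ => 1 / ((j : ℝ) + 1)) atTop (𝓝 0) :=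
    tendsto_one_div_add_atTop_nhds_zero_nat
  have hqp : Tendsto q atTop (𝓝 p) := by
    rw [tendsto_iff_dist_tendsto_zero]
    exact squeeze_zero (fun _ => dist_nonneg) (fun j => (Metric.mem_ball.1 (hq j).2).le) hto
  have : ProperSpace Y := FiniteDimensional.proper ℝ _
  obtain ⟨v, -, φ, hφ, hv⟩ := (isCompact_closedBall (0 : Y) 1).tendsto_subseq
    (x := fun j => (d j).snd) fun j => by rw [mem_closedBall_zero_iff, hd1]
  have hv1 : ‖v‖ = 1 := tendsto_nhds_unique hv.norm
    (tendsto_const_nhds.congr fun j => (hd1 (φ j)).symm)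
  have hu : Tendsto (fun j => (d (φ j)).fst) atTop (𝓝 0) :=
    (squeeze_zero_norm hd2 hto).comp hφ.tendsto_atTop
  have hd : Tendsto (fun j => d (φ j)) atTop (𝓝 (pair 0 v)) :=
    ((WithLp.prod_continuous_toLp 2 X Y).tendsto (0, v)).comp (hu.prodMk_nhds hv)
  have hqφ : Tendsto (fun j => q (φ j)) atTop (𝓝 p) := hqp.comp hφ.tendsto_atTop
  have hDf : Tendsto (fun j => fderiv ℝ f (q (φ j)) (d (φ j))) atTop
      (𝓝 (fderiv ℝ f p (pair 0 v))) :=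
    (isBoundedBilinearMap_apply.continuous.tendsto (fderiv ℝ f p, pair 0 v)).comp
      ((((hf.continuous_fderiv one_ne_zero).tendsto p).comp hqφ).prodMk_nhds hd)
  have hv0 : v = 0 := by
    refine h v ⟨fun j => pair (q (φ j)) (-f (q (φ j))), fun j => pair (d (φ j)) _,
      fun j => mem_gph_solutionMap.1 (hq (φ j)).1, ?_, ?_, fun j => hd3 (φ j)⟩
    · exact ((WithLp.prod_continuous_toLp 2 (Prod2 X Y) Z).tendsto (p, -f p)).comp
        (hqφ.prodMk_nhds ((hf.continuous.tendsto p).comp hqφ).neg)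
    · exact ((WithLp.prod_continuous_toLp 2 (Prod2 X Y) Z).tendsto (_, _)).comp
        (hd.prodMk_nhds hDf.neg)
  rw [hv0, norm_zero] at hv1
  exact zero_ne_one hv1

end Calmness

end VarAnalysis

theorem proposition5p2 (l k : ℕ)
    (f : Prod2 (EuclideanSpace ℝ (Fin l)) (EuclideanSpace ℝ (Fin k)) → EuclideanSpace ℝ (Fin k))
    (hf : ContDiff ℝ 1 f)
    (Q : Prod2 (EuclideanSpace ℝ (Fin l)) (EuclideanSpace ℝ (Fin k)) →
      Set (EuclideanSpace ℝ (Fin k)))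
    (hQ : IsClosed (gph Q))
    (xbar : EuclideanSpace ℝ (Fin l)) (ybar : EuclideanSpace ℝ (Fin k))
    (hbar : (0 : EuclideanSpace ℝ (Fin k)) ∈ geMap f Q (pair xbar ybar)) :
    -- condition (i)
    ((∀ v : EuclideanSpace ℝ (Fin k),
        (0 : EuclideanSpace ℝ (Fin k)) ∈ {partialDerivY f xbar ybar v} +
          outerGraphicalDeriv Q (pair (pair xbar ybar) (-f (pair xbar ybar))) (pair 0 v) →
        v = 0) →
      IsolatedlyCalmAround (solutionMap (geMap f Q)) (pair xbar ybar)) ∧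
    -- the primal and the dual form of the implication in condition (ii) are equivalent
    ((∀ M ∈ scDeriv Q (pair (pair xbar ybar) (-f (pair xbar ybar))),
        ∀ v : EuclideanSpace ℝ (Fin k),
          pair (pair 0 v) (-partialDerivY f xbar ybar v) ∈ M → v = 0) ↔
      (∀ Ms ∈ scCoderiv Q (pair (pair xbar ybar) (-f (pair xbar ybar))),
        ∀ (ws : EuclideanSpace ℝ (Fin k)) (us : EuclideanSpace ℝ (Fin l)),
          pair ws (pair us (-(partialDerivY f xbar ybar).adjoint ws)) ∈ Ms →
            ws = 0 ∧ us = 0)) ∧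
    -- condition (ii)
    (SCDAround Q (pair (pair xbar ybar) (-f (pair xbar ybar))) →
      SemismoothStarAround Q (pair (pair xbar ybar) (-f (pair xbar ybar))) →
      ((∀ M ∈ scDeriv Q (pair (pair xbar ybar) (-f (pair xbar ybar))),
          ∀ v : EuclideanSpace ℝ (Fin k),
            pair (pair 0 v) (-partialDerivY f xbar ybar v) ∈ M → v = 0) ∨
        (∀ Ms ∈ scCoderiv Q (pair (pair xbar ybar) (-f (pair xbar ybar))),
          ∀ (ws : EuclideanSpace ℝ (Fin k)) (us : EuclideanSpace ℝ (Fin l)),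
            pair ws (pair us (-(partialDerivY f xbar ybar).adjoint ws)) ∈ Ms →
              ws = 0 ∧ us = 0)) →
      IsolatedlyCalmAround (solutionMap (geMap f Q)) (pair xbar ybar)) := by

  have hdiff : Differentiable ℝ f := hf.differentiable one_ne_zero
  have hp := mem_gph_solutionMap.2 (zero_mem_geMap_iff.1 hbar)
  have hequiv := forall_scDeriv_iff_forall_scCoderiv rfl Q
    (pair (pair xbar ybar) (-f (pair xbar ybar))) (partialDerivY f xbar ybar)
  refine ⟨fun h => ?_, hequiv, fun hscd hss hor => ?_⟩
  · refine isolatedlyCalmAround_of_outerTangentCone hf hp fun v hv => h v ?_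
    rw [Set.singleton_add]
    rw [← partialDerivY_apply (hdiff _)] at hv
    exact ⟨_, hv, add_neg_cancel _⟩
  -- The dual alternative is first converted to the primal one, which can be tested on the subspace
  -- containing the given outer limiting tangent.
  · have hprimal := hor.elim id hequiv.2
    refine isolatedlyCalmAround_of_outerTangentCone hf hp fun v hv => ?_
    obtain ⟨M, hM, hvM⟩ := exists_mem_scDeriv_of_mem_outerTangentCone hscd hss hv
    rw [← partialDerivY_apply (hdiff _)] at hvM
    exact hprimal M hM v hvM
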